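/- For $i\in\mathbb{N}$ (including $i=0$) let $R(i,2i+1)\subseteq\mathbb{F}_2^{2^{2i+1}}$ be the Reed–Muller code consisting of the value tables, on $\mathbb{F}_2^{2i+1}$, of all polynomials over $\mathbb{F}_2$ in $2i+1$ variables of total degree at most $i$. This code is self-dual. For each $i$ choose a coordinate $p_i$, let $C_{i,1}$ be the code $R(i,2i+1)$ punctured at $p_i$ (coordinate $p_i$ is deleted from all codewords), let $C_{i,2}:=C_{i,1}^{\perp}$, and let $R_i:=CSS(C_{i,1},C_{i,2})$, that is, $C_{i,2}\subseteq C_{i,1}$ and the logical basis states of $R_i$ are the coset states $|v+C_{i,2}\rangle=|C_{i,2}|^{-1/2}\sum_{c\in C_{i,2}}|v+c\rangle$, with $v$ ranging over representatives of $C_{i,1}/C_{i,2}$. Then, for every choice of the coordinates $p_i$: 1. $R_i$ exists and is an $[[n(i),1,d(i)]]$ quantum code with $n(i)=2^{2i+1}-1$ and $d(i)=2^{i+1}-1$, where the distance of a code is the minimum weight of a Pauli that maps some logical basis state $|x_L\rangle$ to a different one $|y_L\rangle$. 2. The benign distance of $R_i$ is at least $d(i)$, where a Pauli $P$ is called benign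 if $P|x_L\rangle=|x_L\rangle$ for all $x$, and the benign distance is the minimum weight of a benign non-identity Pauli ($\infty$ if there is none). 3. The family $(R_i)_{i\in\mathbb{N}}$ is weight-sparse: let $A_i(x,y,z)$ be the set of $n(i)$-qubit Paulis with exactly $x$ tensor factors $\mathsf{X}$, $y$ factors $\mathsf{Y}$ and $z$ factors $\mathsf{Z}$ (all the others being $\mathsf{I}$), and let $B_i(x,y,z)$ be the set of benign Paulis in $A_i(x,y,z)$. Then $$f(i):=\max_{\substack{0<x+y+z\le n(i)}}\frac{|B_i(x,y,z)|}{|A_i(x,y,z)|}$$ is negligible in $n(i)$, i.e. for every $c\in\mathbb{N}$ there is an $i_0$ such that $f(i)<n(i)^{-c}$ for all $i\ge i_0$. Here Paulis are strings in $\{\mathsf{I},\mathsf{X},\mathsf{Y},\mathsf{Z}\}^{n}$, taken up to a global phase (so the equations $P|x_L\rangle=|y_L\rangle$, and $P|x_L\rangle=|x_L\rangle$ for all $x$, are required to hold after multiplication of $P$ by one phase). -/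

import Mathlib

open scoped NNReal

noncomputable section

/-! ### Classical binary linear codes -/

/-- A binary linear code with coordinates indexed by `κ`. -/
abbrev BinCode (κ : Type) := Submodule (ZMod 2) (κ → ZMod 2)

/-- The dual code, with respect to the standard dot product modulo `2`. -/
def BinCode.dual {κ : Type} [Fintype κ] (C : BinCode κ) : BinCode κ where
  carrier := {v | ∀ c ∈ C, c ⬝ᵥ v = 0}
  add_mem' := by
    intro a b ha hb c hc
    rw [dotProduct_add, ha c hc, hb c hc, add_zero]
  zero_mem' := by
    intro c _
    exact dotProduct_zero c
  smul_mem' := by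
    intro r a ha c hc
    rw [dotProduct_smul, ha c hc, smul_zero]

/-- The code punctured at the position `p`: that coordinate is deleted from every codeword. -/
def BinCode.puncture {κ : Type} (C : BinCode κ) (p : κ) : BinCode {v : κ // v ≠ p} :=
  C.map (LinearMap.funLeft (ZMod 2) (ZMod 2) (Subtype.val : {v : κ // v ≠ p} → κ))

/-- The Reed-Muller code `R(r, a)`: the tables of values on `𝔽₂ᵃ` of the polynomials in `a`
variables over `𝔽₂` of total degree at most `r`. The coordinates are the `2 ^ a` points. -/
def reedMuller (r a : ℕ) : BinCode (Fin a → ZMod 2) :=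
  (MvPolynomial.restrictTotalDegree (Fin a) (ZMod 2) r).map (MvPolynomial.evalₗ (ZMod 2) (Fin a))

/-! ### Qubits and Pauli operators -/

/-- The state space of a register of qubits indexed by `ι`; the computational basis is indexed by
bit strings. -/
abbrev Qubits (ι : Type) [Fintype ι] [DecidableEq ι] := EuclideanSpace ℂ (ι → ZMod 2)

/-- The four one-qubit Paulis. -/
inductive Pauli1 where
  | I | X | Y | Z
  deriving DecidableEq

instance : Fintype Pauli1 where
  elems := {.I, .X, .Y, .Z}
  complete := by intro s; cases s <;> simp

/-- The matrix of a one-qubit Pauli. -/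
def Pauli1.mat : Pauli1 → Matrix (ZMod 2) (ZMod 2) ℂ
  | .I => 1
  | .X => Matrix.of fun a b => if a = b then 0 else 1
  | .Y => Matrix.of fun a b => if a = b then 0 else if a = 0 then -Complex.I else Complex.I
  | .Z => Matrix.of fun a b => if a = b then (if a = 0 then 1 else -1) else 0

/-- The Paulis on the qubits `ι`, up to global phase: a choice of `I`, `X`, `Y` or `Z` at
each qubit (equivalently, a `2 n`-bit string of bit-flip and phase-flip positions). -/
abbrev Pauli (ι : Type) := ι → Pauli1

namespace Pauli

variable {ι : Type} [Fintype ι] [DecidableEq ι]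

/-- The tensor product operator of a Pauli. -/
def op (P : Pauli ι) : Qubits ι →ₗ[ℂ] Qubits ι :=
  Matrix.toEuclideanLin (Matrix.of fun a b : ι → ZMod 2 => ∏ j, (P j).mat (a j) (b j))

/-- The number of positions at which `P` is equal to `s`. -/
def count (s : Pauli1) (P : Pauli ι) : ℕ := (Finset.univ.filter fun j => P j = s).card

/-- The weight: the number of positions at which `P` is not the identity. -/
def weight (P : Pauli ι) : ℕ := (Finset.univ.filter fun j => P j ≠ Pauli1.I).card

/-- `P` maps `ψ x` to `φ x` for all `x`, after multiplication by one global phase (as Paulis are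
taken up to phase). -/
def Maps {κ : Type} (P : Pauli ι) (ψ φ : κ → Qubits ι) : Prop :=
  ∃ c : ℂ, ‖c‖ = 1 ∧ ∀ x, c • P.op (ψ x) = φ x

end Pauli

/-! ### Quantum error-correcting codes -/

/-- An `[[n, m]]` quantum code on the qubits `ι` (with `n` the number of elements of `ι`), given by
its encoding unitary on `m` message qubits and `n - m` tag qubits. -/
structure QECC (ι : Type) [Fintype ι] [DecidableEq ι] (m : ℕ) where
  V : EuclideanSpace ℂ ((Fin m → ZMod 2) × (Fin (Fintype.card ι - m) → ZMod 2)) ≃ₗᵢ[ℂ] Qubits ι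

namespace QECC

variable {ι : Type} [Fintype ι] [DecidableEq ι] {m : ℕ}

/-- The logical state `|x_L⟩ = V (|x⟩ ⊗ |0…0⟩)`. -/
def logical (E : QECC ι m) (x : Fin m → ZMod 2) : Qubits ι :=
  E.V (EuclideanSpace.single (x, 0) 1)

/-- The (conventional) distance: the least weight of a Pauli that maps some logical basis state
to a different one. -/
def distance (E : QECC ι m) : ℕ∞ :=
  ⨅ P ∈ {P : Pauli ι | ∃ x y, x ≠ y ∧
    P.Maps (fun _ : Unit => E.logical x) (fun _ : Unit => E.logical y)}, (P.weight : ℕ∞)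

/-- A Pauli is benign if it fixes all logical basis states. -/
def Benign (E : QECC ι m) (P : Pauli ι) : Prop := P.Maps E.logical E.logical

/-- The benign distance: the least weight of a non-identity benign Pauli (`⊤` if none exists). -/
def benignDistance (E : QECC ι m) : ℕ∞ :=
  ⨅ P ∈ {P : Pauli ι | (P ≠ fun _ => Pauli1.I) ∧ E.Benign P}, (P.weight : ℕ∞)

/-- The normalised uniform superposition `|v + C⟩` of the elements of the coset `v + C`. -/
def cosetState (C : BinCode ι) (v : ι → ZMod 2) : Qubits ι :=
  WithLp.toLp 2 (Set.indicator {u | u - v ∈ C} fun _ => ((Real.sqrt (Nat.card C) : ℝ) : ℂ)⁻¹)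

/-- `E` is a code `CSS(C₁, C₂)`: here `C₂ ⊆ C₁`, and the logical basis states are the coset states
`|r + C₂⟩`, where `r` runs through a complete set of representatives of `C₁ / C₂`. -/
def IsCSS (E : QECC ι m) (C₁ C₂ : BinCode ι) : Prop :=
  C₂ ≤ C₁ ∧ ∃ r : (Fin m → ZMod 2) → (ι → ZMod 2),
    (∀ x, r x ∈ C₁) ∧ (∀ v ∈ C₁, ∃! x, v - r x ∈ C₂) ∧
    ∀ x, E.logical x = cosetState C₂ (r x)

/-- The set `A(x, y, z)` of Paulis with `X`-weight `x`, `Y`-weight `y` and `Z`-weight `z`. -/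
def paulisOfProfile (ι : Type) [Fintype ι] [DecidableEq ι] (w : ℕ × ℕ × ℕ) : Set (Pauli ι) :=
  {P | P.count .X = w.1 ∧ P.count .Y = w.2.1 ∧ P.count .Z = w.2.2}

/-- The set `B(x, y, z)` of benign Paulis in `A(x, y, z)`. -/
def benignOfProfile (E : QECC ι m) (w : ℕ × ℕ × ℕ) : Set (Pauli ι) :=
  {P | P ∈ paulisOfProfile ι w ∧ E.Benign P}

end QECC

/-- The weight profiles `(x, y, z)` with `x + y + z ≤ n`, other than that of the identity. -/
def nontrivialProfiles (n : ℕ) : Finset (ℕ × ℕ × ℕ) :=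
  (Finset.range (n + 1) ×ˢ Finset.range (n + 1) ×ˢ Finset.range (n + 1)).filter
    fun w => w.1 + w.2.1 + w.2.2 ≤ n ∧ w ≠ (0, 0, 0)

/-- The largest fraction of benign Paulis among the Paulis of a nontrivial weight profile. -/
def QECC.maxBenignFraction {ι : Type} [Fintype ι] [DecidableEq ι] {m : ℕ} (E : QECC ι m) : ℝ≥0 :=
  (nontrivialProfiles (Fintype.card ι)).sup fun w =>
    ((E.benignOfProfile w).ncard : ℝ≥0) / ((QECC.paulisOfProfile ι w).ncard : ℝ≥0)

/-- `f` is negligible in `g`. -/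
def NegligibleIn (f g : ℕ → ℝ) : Prop :=
  ∀ c : ℕ, ∃ i₀ : ℕ, ∀ i ≥ i₀, f i < ((g i) ^ c)⁻¹

/-- A weight-sparse family of quantum codes. -/
def WeightSparse {ι : ℕ → Type} [∀ i, Fintype (ι i)] [∀ i, DecidableEq (ι i)] {m : ℕ → ℕ}
    (E : ∀ i, QECC (ι i) (m i)) : Prop :=
  NegligibleIn (fun i => ((E i).maxBenignFraction : ℝ)) (fun i => (Fintype.card (ι i) : ℝ))

/-! ### The punctured Reed-Muller quantum codes -/

/-- The qubits of the `i`-th code: the points of `𝔽₂^(2i+1)` other than the puncture position. -/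
abbrev RMQubit (i : ℕ) (p : Fin (2 * i + 1) → ZMod 2) := {v : Fin (2 * i + 1) → ZMod 2 // v ≠ p}

/-- The code `R(i, 2i+1)`, punctured at the position `p`. -/
def puncturedRM (i : ℕ) (p : Fin (2 * i + 1) → ZMod 2) : BinCode (RMQubit i p) :=
  (reedMuller i (2 * i + 1)).puncture p

/-- `E` is the quantum code obtained from `R(i, 2i+1)` by puncturing at `p` and applying the
CSS construction to the resulting code and its dual. -/
def QECC.IsRM {i m : ℕ} {p : Fin (2 * i + 1) → ZMod 2} (E : QECC (RMQubit i p) m) : Prop :=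
  E.IsCSS (puncturedRM i p) (puncturedRM i p).dual

end

/-!
Let `C = R(i, 2i+1)`, let `C₁` be its puncturing at `p` and `C₂ = C₁^⊥`.

*Reed-Muller codes.* All that is needed about polynomials of degree at most `r` is expressed by sums
over subcubes. The indicator of a subcube with `k` free coordinates is a product of `a - k` affine
forms, hence a polynomial of degree `a - k` in `a` variables, and a polynomial of degree below `a`
sums to `0` over `𝔽₂^a`. So words of `R(r, a)` sum to `0` over each subcube of dimension above `r`.
Conversely, by the algebraic normal form (`eq_sum_sum_cube_mul_prod`), a function with this property
has degree at most `r`. For `r = i` and `a = 2i+1` this is self-duality (`dual_reedMuller`). The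
minimum weight `2 ^ (a - r)` is obtained from a maximal subcube direction with a nonzero sum
(`two_pow_le_card_support`).

*Puncturing.* As `C` is self-dual, `C₂` is `C` shortened at `p` (`mem_dual_puncturedRM`). So nonzero
words of `C₂` have weight at least `2 ^ (i+1)`, those of `C₁` at least `2 ^ (i+1) - 1`, and `C₁` is
the disjoint union of `C₂` and `1 + C₂`, since the length is odd.

*Quantum codes.* Up to a phase, a Pauli is given by its bit flips `x` and phase flips `z`, and it
sends the amplitude at `a + x` to `a` with the sign `(-1)^(z ⬝ (a + x))`. It can only map the coset
state of `v + C₂` to that of `v + x + C₂`, so the distance is the minimum weight of `C₁ \ C₂`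
(`QECC.IsCSS.distance_eq`), and a benign Pauli has `x ∈ C₂` and `z ∈ C₁^⊥ = C₂`
(`QECC.IsCSS.mem_dual_of_benign`). The last fact bounds the benign distance.

*Sparsity.* Each weight profile is invariant under permutations of the qubits, so the positions of
the bit flips of its Paulis are equally distributed over the sets of some size `w`, and similarly
for the phase flips. One of the two sizes is not `0`, and the fraction of benign Paulis is at most
the fraction of those `w`-sets that are supports of words of `C₂`. With `t = 2 ^ i - 1`, the minimum
distance of `C₂` exceeds `2t`, so no two of these supports share a subset of size `w - t`. Counting
such subsets bounds the fraction by `1 / (n - w + t).choose t` (`card_mul_choose_le_choose`). Since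
adding the all-ones word takes `C₂` to nonzero words of `C₁`, `n - w ≥ t`, and the bound is at most
`2 ^ (-t)`, which is negligible in `n < 2 ^ (2i+1)`.
-/

noncomputable section

/-! ### Subcubes and Reed-Muller codes -/

section Cube

variable {σ : Type} [Fintype σ] [DecidableEq σ]

/-- The subcube of `𝔽₂^σ` through `y` whose free coordinates are those in `S`. -/
def cube (S : Finset σ) (y : σ → ZMod 2) : Finset (σ → ZMod 2) :=
  Fintype.piFinset fun j => if j ∈ S then Finset.univ else {y j}

lemma mem_cube {S : Finset σ} {x y : σ → ZMod 2} : x ∈ cube S y ↔ ∀ j ∉ S, x j = y j := by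
  rw [cube, Fintype.mem_piFinset]
  refine forall_congr' fun j => ?_
  by_cases h : j ∈ S <;> simp [h]

lemma card_cube (S : Finset σ) (y : σ → ZMod 2) : (cube S y).card = 2 ^ S.card := by
  rw [cube, Fintype.card_piFinset]
  have h : ∀ j, (if j ∈ S then (Finset.univ : Finset (ZMod 2)) else {y j}).card =
      if j ∈ S then 2 else 1 := by
    intro j
    split_ifs <;> simp [ZMod.card]
  simp [h, Finset.prod_ite_mem]

/-- The indicator function of a subcube as a product of affine linear forms. -/
lemma prod_eq_indicator_cube (S : Finset σ) (x y : σ → ZMod 2) :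
    ∏ j ∈ Sᶜ, (x j + y j + 1) = if x ∈ cube S y then 1 else 0 := by
  split_ifs with h
  · refine Finset.prod_eq_one fun j hj => ?_
    rw [mem_cube.1 h j (Finset.mem_compl.1 hj), CharTwo.add_self_eq_zero, zero_add]
  · rw [mem_cube] at h
    push Not at h
    obtain ⟨j, hj, hne⟩ := h
    refine Finset.prod_eq_zero (Finset.mem_compl.2 hj) ?_
    revert hne
    generalize x j = a
    generalize y j = b
    revert a b
    decide

/-- If the sums of `f` over all subcubes with one more free coordinate than `S` vanish, then `f` has
the same sum over all parallel translates of a subcube with free coordinates `S`: the union of two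
translates that differ in one coordinate is such a larger subcube. -/
lemma sum_cube_eq_sum_cube {S : Finset σ} {f : (σ → ZMod 2) → ZMod 2}
    (hf : ∀ j ∉ S, ∀ y, ∑ x ∈ cube (insert j S) y, f x = 0) (y y' : σ → ZMod 2) :
    ∑ x ∈ cube S y', f x = ∑ x ∈ cube S y, f x := by
  have step : ∀ (z : σ → ZMod 2) (j : σ) (a : ZMod 2),
      ∑ x ∈ cube S (Function.update z j a), f x = ∑ x ∈ cube S z, f x := by
    intro z j a
    by_cases hj : j ∈ S
    · congr 1
      ext x
      simp only [mem_cube]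
      refine forall₂_congr fun k hk => ?_
      rw [Function.update_of_ne (by rintro rfl; exact hk hj)]
    by_cases ha : a = z j
    · rw [ha, Function.update_eq_self]
    have hdisj : Disjoint (cube S (Function.update z j a)) (cube S z) := by
      rw [Finset.disjoint_left]
      intro x hx hx'
      apply ha
      rw [← mem_cube.1 hx' j hj, mem_cube.1 hx j hj, Function.update_self]
    have hunion : cube (insert j S) z = cube S (Function.update z j a) ∪ cube S z := by
      ext x
      simp only [Finset.mem_union, mem_cube, Finset.mem_insert, not_or]
      constructor
      · intro h
        have two : ∀ a b c : ZMod 2, a ≠ b → c = a ∨ c = b := by decide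
        rcases two a (z j) (x j) ha with h' | h'
        · left
          intro k hk
          rcases eq_or_ne k j with rfl | hkj
          · rw [h', Function.update_self]
          · rw [Function.update_of_ne hkj, h k ⟨hkj, hk⟩]
        · right
          intro k hk
          rcases eq_or_ne k j with rfl | hkj
          · exact h'
          · exact h k ⟨hkj, hk⟩
      · rintro (h | h) k ⟨hkj, hk⟩
        · rw [h k hk, Function.update_of_ne hkj]
        · exact h k hk
    have h0 := hf j hj z
    rw [hunion, Finset.sum_union hdisj] at h0
    exact CharTwo.add_eq_zero.1 h0
  have key : ∀ T : Finset σ, ∑ x ∈ cube S (T.piecewise y' y), f x = ∑ x ∈ cube S y, f x := by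
    intro T
    induction T using Finset.induction_on with
    | empty => rw [Finset.piecewise_empty]
    | insert j T _ ih => rw [Finset.piecewise_insert, step, ih]
  simpa using key Finset.univ

/-- The minimum weight bound for Reed-Muller codes: a nonzero function whose sums over the subcubes
of dimension above `r` vanish is nonzero in at least `2 ^ (m - r)` points. For a set `S` of free
coordinates that is maximal among those with a nonzero subcube sum, all parallel translates have
a nonzero sum, so each of them contains a point of the support. -/
lemma two_pow_le_card_support {r : ℕ} {f : (σ → ZMod 2) → ZMod 2} (hf0 : f ≠ 0)
    (hf : ∀ S : Finset σ, r < S.card → ∀ y, ∑ x ∈ cube S y, f x = 0) :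
    2 ^ (Fintype.card σ - r) ≤ (Finset.univ.filter fun x => f x ≠ 0).card := by
  classical
  obtain ⟨x₀, hx₀⟩ := Function.ne_iff.1 hf0
  let F : Finset (Finset σ) := Finset.univ.filter fun S => ∃ y, ∑ x ∈ cube S y, f x ≠ 0
  have hF : F.Nonempty := by
    refine ⟨∅, Finset.mem_filter.2 ⟨Finset.mem_univ _, x₀, ?_⟩⟩
    have : cube ∅ x₀ = {x₀} := by
      ext x
      simp [mem_cube, funext_iff]
    simpa [this] using hx₀
  obtain ⟨S, hS, hmax⟩ := F.exists_max_image Finset.card hF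
  obtain ⟨y₀, hy₀⟩ := (Finset.mem_filter.1 hS).2
  have hcard : S.card ≤ r := by
    by_contra! h
    exact hy₀ (hf S h y₀)
  have hall : ∀ y, ∑ x ∈ cube S y, f x ≠ 0 := by
    intro y
    rwa [sum_cube_eq_sum_cube (f := f) (S := S) (y := y₀) (y' := y)]
    intro j hj z
    by_contra h
    have := hmax (insert j S) (Finset.mem_filter.2 ⟨Finset.mem_univ _, z, h⟩)
    rw [Finset.card_insert_of_notMem hj] at this
    omega
  have hsurj : Set.SurjOn (fun (x : σ → ZMod 2) (j : {j // j ∉ S}) => x j)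
      (Finset.univ.filter fun x => f x ≠ 0 : Finset (σ → ZMod 2))
      (Finset.univ : Finset ({j // j ∉ S} → ZMod 2)) := by
    intro g _
    obtain ⟨x, hx, hfx⟩ := Finset.exists_ne_zero_of_sum_ne_zero
      (hall fun j => if h : j ∉ S then g ⟨j, h⟩ else 0)
    refine ⟨x, by simpa using hfx, ?_⟩
    ext ⟨j, hj⟩
    simp [mem_cube.1 hx j hj, hj]
  refine le_trans ?_ (Finset.card_le_card_of_surjOn _ hsurj)
  rw [Finset.card_univ, Fintype.card_fun, ZMod.card, Fintype.card_subtype_compl,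
    Fintype.card_coe]
  exact Nat.pow_le_pow_right two_pos (by omega)

/-- The algebraic normal form: the coefficient of `∏ j ∈ S, x j` in the reduced polynomial of a
function `f` is the sum of `f` over the subcube through `0` with free coordinates `S`. -/
lemma eq_sum_sum_cube_mul_prod (f : (σ → ZMod 2) → ZMod 2) (x : σ → ZMod 2) :
    f x = ∑ S : Finset σ, (∑ z ∈ cube S 0, f z) * ∏ j ∈ S, x j := by
  have h : ∀ S : Finset σ, (∑ z ∈ cube S 0, f z) * ∏ j ∈ S, x j =
      ∑ z, f z * ((∏ j ∈ S, x j) * ∏ j ∈ Finset.univ \ S, (z j + 1)) := by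
    intro S
    rw [← Finset.compl_eq_univ_sdiff, Finset.sum_mul]
    have h' : ∀ z : σ → ZMod 2, ∏ j ∈ Sᶜ, (z j + 1) = if z ∈ cube S 0 then 1 else 0 := by
      intro z
      simp [← prod_eq_indicator_cube]
    simp [h', Finset.sum_ite_mem]
  simp_rw [h]
  rw [Finset.sum_comm]
  simp_rw [← Finset.mul_sum]
  rw [← Finset.powerset_univ]
  simp_rw [← Finset.prod_add]
  have h' : ∀ z : σ → ZMod 2, ∏ j, (x j + (z j + 1)) = if z = x then 1 else 0 := by
    intro z
    have := prod_eq_indicator_cube ∅ x z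
    simp only [Finset.compl_empty, mem_cube, Finset.notMem_empty, not_false_eq_true, forall_const,
      ← funext_iff] at this
    simp_rw [← add_assoc, this, eq_comm]
  simp [h']

end Cube

section ReedMuller

lemma mem_reedMuller {r a : ℕ} {v : (Fin a → ZMod 2) → ZMod 2} :
    v ∈ reedMuller r a ↔ ∃ f : MvPolynomial (Fin a) (ZMod 2), f.totalDegree ≤ r ∧
      ∀ x, MvPolynomial.eval x f = v x := by
  simp only [reedMuller, Submodule.mem_map, MvPolynomial.mem_restrictTotalDegree, funext_iff,
    MvPolynomial.evalₗ_apply]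

/-- The product of two polynomials of degrees adding up to less than the number of variables sums
to `0` over the cube. -/
lemma dotProduct_eq_zero_of_mem_reedMuller {r s a : ℕ} (h : r + s < a)
    {v w : (Fin a → ZMod 2) → ZMod 2} (hv : v ∈ reedMuller r a) (hw : w ∈ reedMuller s a) :
    v ⬝ᵥ w = 0 := by
  obtain ⟨f, hf, hfv⟩ := mem_reedMuller.1 hv
  obtain ⟨g, hg, hgw⟩ := mem_reedMuller.1 hw
  have := MvPolynomial.sum_eval_eq_zero (f * g) (by
    have := MvPolynomial.totalDegree_mul f g
    rw [ZMod.card, Fintype.card_fin]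
    omega)
  simpa [dotProduct, hfv, hgw] using this

lemma indicator_cube_mem_reedMuller {r a : ℕ} {S : Finset (Fin a)} (hS : a ≤ r + S.card)
    (y : Fin a → ZMod 2) : (fun x => if x ∈ cube S y then 1 else 0) ∈ reedMuller r a := by
  refine mem_reedMuller.2 ⟨∏ j ∈ Sᶜ, (MvPolynomial.X j + MvPolynomial.C (y j + 1)), ?_, ?_⟩
  · refine (MvPolynomial.totalDegree_finsetProd _ _).trans ?_
    refine (Finset.sum_le_card_nsmul _ _ 1 fun j _ => ?_).trans ?_
    · refine (MvPolynomial.totalDegree_add _ _).trans ?_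
      rw [MvPolynomial.totalDegree_X, MvPolynomial.totalDegree_C]
      rfl
    · rw [Finset.card_compl, Fintype.card_fin]
      simp
      omega
  · intro x
    rw [← prod_eq_indicator_cube]
    simp [add_assoc]

lemma sum_cube_eq_zero_of_mem_reedMuller {r a : ℕ} {v : (Fin a → ZMod 2) → ZMod 2}
    (hv : v ∈ reedMuller r a) (S : Finset (Fin a)) (hS : r < S.card) (y : Fin a → ZMod 2) :
    ∑ x ∈ cube S y, v x = 0 := by
  have hSa : S.card ≤ a := by simpa using S.card_le_univ
  have := dotProduct_eq_zero_of_mem_reedMuller (by omega)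
    (indicator_cube_mem_reedMuller (r := a - S.card) (S := S) (by omega) y) hv
  simpa [dotProduct, Finset.sum_ite_mem] using this

lemma two_pow_le_card_support_of_mem_reedMuller {r a : ℕ} {v : (Fin a → ZMod 2) → ZMod 2}
    (hv : v ∈ reedMuller r a) (hv0 : v ≠ 0) :
    2 ^ (a - r) ≤ (Finset.univ.filter fun x => v x ≠ 0).card := by
  simpa using two_pow_le_card_support hv0 (sum_cube_eq_zero_of_mem_reedMuller hv)

lemma mem_reedMuller_of_sum_cube_eq_zero {r a : ℕ} {v : (Fin a → ZMod 2) → ZMod 2}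
    (hv : ∀ S : Finset (Fin a), r < S.card → ∑ x ∈ cube S 0, v x = 0) : v ∈ reedMuller r a := by
  refine mem_reedMuller.2 ⟨∑ S : Finset (Fin a) with S.card ≤ r,
    MvPolynomial.C (∑ z ∈ cube S 0, v z) * ∏ j ∈ S, MvPolynomial.X j, ?_, ?_⟩
  · refine MvPolynomial.totalDegree_finsetSum_le fun S hS => ?_
    refine (MvPolynomial.totalDegree_mul _ _).trans ?_
    rw [MvPolynomial.totalDegree_C, zero_add]
    refine (MvPolynomial.totalDegree_finsetProd _ _).trans ?_
    simpa using hS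
  · intro x
    rw [eq_sum_sum_cube_mul_prod v x, MvPolynomial.eval_sum, Finset.sum_filter]
    refine Finset.sum_congr rfl fun S _ => ?_
    split_ifs with h
    · simp
    · rw [hv S (not_le.1 h), zero_mul]

lemma dual_reedMuller (i : ℕ) :
    (reedMuller i (2 * i + 1)).dual = reedMuller i (2 * i + 1) := by
  apply le_antisymm
  · intro v hv
    refine mem_reedMuller_of_sum_cube_eq_zero fun S hS => ?_
    have := hv _ (indicator_cube_mem_reedMuller (S := S) (by omega) 0)
    simpa [dotProduct, Finset.sum_ite_mem] using this
  · intro v hv c hc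
    exact dotProduct_eq_zero_of_mem_reedMuller (by omega) hc hv

end ReedMuller

/-! ### Punctured self-dual codes -/

section Puncture

variable {κ : Type} {p : κ}

lemma mem_puncture {C : BinCode κ} {v : {x : κ // x ≠ p} → ZMod 2} :
    v ∈ C.puncture p ↔ ∃ c ∈ C, (fun x : {x : κ // x ≠ p} => c x) = v := Iff.rfl

variable [DecidableEq κ]

/-- The extension of a word of a punctured code by `0` at the deleted position. -/
def extendZero (v : {x : κ // x ≠ p} → ZMod 2) (x : κ) : ZMod 2 :=
  if h : x ≠ p then v ⟨x, h⟩ else 0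

lemma extendZero_apply (v : {x : κ // x ≠ p} → ZMod 2) (x : {x : κ // x ≠ p}) :
    extendZero v x = v x := dif_pos x.2

lemma extendZero_self (v : {x : κ // x ≠ p} → ZMod 2) : extendZero v p = 0 :=
  dif_neg (not_not.2 rfl)

lemma extendZero_ne_zero {v : {x : κ // x ≠ p} → ZMod 2} (hv : v ≠ 0) : extendZero v ≠ 0 := by
  intro h
  refine hv (funext fun x => ?_)
  rw [← extendZero_apply v x, h]
  rfl

variable [Fintype κ]

lemma hammingNorm_eq_add_hammingNorm_puncture (c : κ → ZMod 2) (p : κ) :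
    hammingNorm c =
      (if c p ≠ 0 then 1 else 0) + hammingNorm fun x : {x : κ // x ≠ p} => c x := by
  simp only [hammingNorm, Finset.card_filter]
  exact Fintype.sum_eq_add_sum_subtype_ne _ p

lemma hammingNorm_extendZero (v : {x : κ // x ≠ p} → ZMod 2) :
    hammingNorm (extendZero v) = hammingNorm v := by
  rw [hammingNorm_eq_add_hammingNorm_puncture _ p, extendZero_self]
  simp [extendZero_apply]

/-- The dual of the punctured code is the shortened dual code. -/
lemma mem_dual_puncture {C : BinCode κ} {v : {x : κ // x ≠ p} → ZMod 2} :
    v ∈ (C.puncture p).dual ↔ extendZero v ∈ C.dual := by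
  have h : ∀ c : κ → ZMod 2,
      c ⬝ᵥ extendZero v = (fun x : {x : κ // x ≠ p} => c x) ⬝ᵥ v := by
    intro c
    rw [dotProduct, Fintype.sum_eq_add_sum_subtype_ne _ p, extendZero_self, mul_zero, zero_add]
    simp [dotProduct, extendZero_apply]
  constructor
  · intro hv c hc
    rw [h]
    exact hv _ (mem_puncture.2 ⟨c, hc, rfl⟩)
  · intro hv w hw
    obtain ⟨c, hc, rfl⟩ := mem_puncture.1 hw
    rw [← h]
    exact hv c hc

end Puncture

/-! ### The punctured Reed-Muller code and its dual -/

section PuncturedRM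

variable {i : ℕ} {p : Fin (2 * i + 1) → ZMod 2}

lemma card_RMQubit (i : ℕ) (p : Fin (2 * i + 1) → ZMod 2) :
    Fintype.card (RMQubit i p) = 2 ^ (2 * i + 1) - 1 := by
  rw [Fintype.card_subtype_compl, Fintype.card_subtype_eq, Fintype.card_fun, ZMod.card,
    Fintype.card_fin]

lemma le_hammingNorm_of_mem_reedMuller {c : (Fin (2 * i + 1) → ZMod 2) → ZMod 2}
    (hc : c ∈ reedMuller i (2 * i + 1)) (hc0 : c ≠ 0) : 2 ^ (i + 1) ≤ hammingNorm c := by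
  have := two_pow_le_card_support_of_mem_reedMuller hc hc0
  rwa [show 2 * i + 1 - i = i + 1 by omega] at this

lemma mem_dual_puncturedRM {v : RMQubit i p → ZMod 2} :
    v ∈ (puncturedRM i p).dual ↔ extendZero v ∈ reedMuller i (2 * i + 1) := by
  rw [puncturedRM, mem_dual_puncture, dual_reedMuller]

lemma dual_puncturedRM_le : (puncturedRM i p).dual ≤ puncturedRM i p := fun v hv =>
  mem_puncture.2 ⟨extendZero v, mem_dual_puncturedRM.1 hv, funext (extendZero_apply v)⟩

lemma le_hammingNorm_of_mem_dual_puncturedRM {v : RMQubit i p → ZMod 2}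
    (hv : v ∈ (puncturedRM i p).dual) (hv0 : v ≠ 0) : 2 ^ (i + 1) ≤ hammingNorm v := by
  rw [← hammingNorm_extendZero]
  exact le_hammingNorm_of_mem_reedMuller (mem_dual_puncturedRM.1 hv) (extendZero_ne_zero hv0)

lemma le_hammingNorm_of_mem_puncturedRM {v : RMQubit i p → ZMod 2}
    (hv : v ∈ puncturedRM i p) (hv0 : v ≠ 0) : 2 ^ (i + 1) - 1 ≤ hammingNorm v := by
  obtain ⟨c, hc, rfl⟩ := mem_puncture.1 hv
  have h := le_hammingNorm_of_mem_reedMuller hc (by rintro rfl; exact hv0 rfl)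
  rw [hammingNorm_eq_add_hammingNorm_puncture c p] at h
  split_ifs at h <;> omega

lemma one_mem_reedMuller (r a : ℕ) : 1 ∈ reedMuller r a :=
  mem_reedMuller.2 ⟨1, by simp, by simp⟩

lemma one_mem_puncturedRM : 1 ∈ puncturedRM i p :=
  mem_puncture.2 ⟨1, one_mem_reedMuller _ _, rfl⟩

/-- The all-ones word is not in the dual since the length is odd. -/
lemma one_notMem_dual_puncturedRM : 1 ∉ (puncturedRM i p).dual := by
  intro h
  have h1 := h 1 one_mem_puncturedRM
  rw [one_dotProduct_one, card_RMQubit, Nat.cast_sub Nat.one_le_two_pow, pow_succ] at h1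
  have h2 : ((2 : ℕ) : ZMod 2) = 0 := rfl
  rw [Nat.cast_mul, h2, mul_zero] at h1
  revert h1
  decide

/-- The dual has index `2` in the punctured code, with cosets represented by `0` and `1`. -/
lemma mem_dual_or_sub_one_mem_dual {v : RMQubit i p → ZMod 2} (hv : v ∈ puncturedRM i p) :
    v ∈ (puncturedRM i p).dual ∨ v - 1 ∈ (puncturedRM i p).dual := by
  obtain ⟨c, hc, rfl⟩ := mem_puncture.1 hv
  have hext : ∀ d : (Fin (2 * i + 1) → ZMod 2) → ZMod 2, d p = 0 →
      extendZero (fun x : RMQubit i p => d x) = d := by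
    intro d hd
    funext x
    by_cases hx : x = p
    · rw [hx, extendZero_self, hd]
    · exact extendZero_apply (fun x : RMQubit i p => d x) ⟨x, hx⟩
  have two : ∀ a : ZMod 2, a = 0 ∨ a - 1 = 0 := by decide
  rcases two (c p) with h | h
  · left
    rwa [mem_dual_puncturedRM, hext c h]
  · right
    rw [mem_dual_puncturedRM]
    change extendZero (fun x : RMQubit i p => (c - 1) x) ∈ _
    rw [hext (c - 1) h]
    exact sub_mem hc (one_mem_reedMuller _ _)

/-- The indicator of a subcube of dimension `i + 1` through the puncture position becomes a word
of minimum weight outside the dual code. -/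
lemma exists_mem_puncturedRM_hammingNorm_eq (i : ℕ) (p : Fin (2 * i + 1) → ZMod 2) :
    ∃ v ∈ puncturedRM i p, v ∉ (puncturedRM i p).dual ∧ hammingNorm v = 2 ^ (i + 1) - 1 := by
  obtain ⟨S, -, hS⟩ := Finset.exists_subset_card_eq
    (s := (Finset.univ : Finset (Fin (2 * i + 1)))) (n := i + 1) (by simp; omega)
  let c : (Fin (2 * i + 1) → ZMod 2) → ZMod 2 := fun x => if x ∈ cube S p then 1 else 0
  have hc : c ∈ reedMuller i (2 * i + 1) := indicator_cube_mem_reedMuller (by omega) p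
  have hcp : c p ≠ 0 := by simp [c, mem_cube]
  have hnorm : hammingNorm c = 2 ^ (i + 1) := by
    rw [← hS, ← card_cube S p, hammingNorm]
    simp [c]
  obtain ⟨v, hvc⟩ : ∃ v, (fun x : RMQubit i p => c x) = v := ⟨_, rfl⟩
  have hv : hammingNorm v + 1 = 2 ^ (i + 1) := by
    rw [← hnorm, hammingNorm_eq_add_hammingNorm_puncture c p, if_pos hcp, hvc, add_comm]
  have hpow : 2 ≤ 2 ^ (i + 1) := by
    rw [pow_succ]
    have := Nat.one_le_two_pow (n := i)
    omega
  refine ⟨v, mem_puncture.2 ⟨c, hc, hvc⟩, fun h => ?_, by omega⟩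
  have := le_hammingNorm_of_mem_dual_puncturedRM h (by
    rintro rfl
    rw [hammingNorm_zero] at hv
    omega)
  omega

end PuncturedRM

/-! ### Paulis acting on coset states -/

/-- The bit-flip part of a one-qubit Pauli. -/
def Pauli1.xBit : Pauli1 → ZMod 2
  | .I => 0
  | .X => 1
  | .Y => 1
  | .Z => 0

/-- The phase-flip part of a one-qubit Pauli. -/
def Pauli1.zBit : Pauli1 → ZMod 2
  | .I => 0
  | .X => 0
  | .Y => 1
  | .Z => 1

/-- The phase by which a one-qubit Pauli differs from the product of its bit flip and its phase
flip: `Y = i X Z`. -/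
def Pauli1.phase : Pauli1 → ℂ
  | .Y => Complex.I
  | _ => 1

/-- The sign `(-1)^t`. -/
def bitSign (t : ZMod 2) : ℂ := if t = 0 then 1 else -1

lemma bitSign_zero : bitSign 0 = 1 := if_pos rfl

lemma bitSign_eq_one_iff {t : ZMod 2} : bitSign t = 1 ↔ t = 0 := by
  unfold bitSign
  split_ifs with h
  · simp [h]
  · simp only [h, iff_false]
    norm_num

lemma bitSign_add (s t : ZMod 2) : bitSign (s + t) = bitSign s * bitSign t := by
  have key : ∀ s t : ZMod 2, (s + t = 0 ↔ (s = 0 ↔ t = 0)) := by decide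
  simp only [bitSign, key]
  by_cases hs : s = 0 <;> by_cases ht : t = 0 <;> simp [hs, ht]

lemma bitSign_sum {α : Type} (s : Finset α) (f : α → ZMod 2) :
    bitSign (∑ j ∈ s, f j) = ∏ j ∈ s, bitSign (f j) := by
  classical
  induction s using Finset.induction_on with
  | empty => simp [bitSign_zero]
  | insert a s ha ih => rw [Finset.sum_insert ha, Finset.prod_insert ha, bitSign_add, ih]

lemma Pauli1.mat_apply (s : Pauli1) (a b : ZMod 2) :
    s.mat a b = if b = a + s.xBit then s.phase * bitSign (s.zBit * b) else 0 := by
  have two : ∀ a : ZMod 2, a = 0 ∨ a = 1 := by decide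
  rcases two a with rfl | rfl <;> rcases two b with rfl | rfl <;> cases s <;>
    simp [Pauli1.mat, Pauli1.xBit, Pauli1.zBit, Pauli1.phase, bitSign, CharTwo.add_self_eq_zero]

namespace Pauli

variable {ι : Type}

/-- The bit-flip positions of a Pauli. -/
def xPart (P : Pauli ι) (j : ι) : ZMod 2 := (P j).xBit

/-- The phase-flip positions of a Pauli. -/
def zPart (P : Pauli ι) (j : ι) : ZMod 2 := (P j).zBit

lemma eq_identity_of_xPart_zPart_eq_zero {P : Pauli ι} (hx : P.xPart = 0) (hz : P.zPart = 0) :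
    P = fun _ => Pauli1.I := by
  funext j
  have hx := congrFun hx j
  have hz := congrFun hz j
  revert hx hz
  simp only [xPart, zPart]
  cases P j <;> simp [Pauli1.xBit, Pauli1.zBit]

variable [Fintype ι]

lemma hammingNorm_xPart_le_weight (P : Pauli ι) : hammingNorm P.xPart ≤ P.weight := by
  refine Finset.card_le_card (Finset.monotone_filter_right _ fun j _ hj h => hj ?_)
  rw [xPart, h, Pauli1.xBit]

lemma hammingNorm_zPart_le_weight (P : Pauli ι) : hammingNorm P.zPart ≤ P.weight := by
  refine Finset.card_le_card (Finset.monotone_filter_right _ fun j _ hj h => hj ?_)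
  rw [zPart, h, Pauli1.zBit]

variable [DecidableEq ι]

lemma op_apply (P : Pauli ι) (ψ : Qubits ι) (a : ι → ZMod 2) :
    P.op ψ a = (∏ j, (P j).phase) * bitSign (P.zPart ⬝ᵥ (a + P.xPart)) * ψ (a + P.xPart) := by
  have h : P.op ψ a = ∑ b, (∏ j, (P j).mat (a j) (b j)) * ψ b := by
    rfl
  rw [h, Finset.sum_eq_single (a + P.xPart)]
  · simp only [Pauli1.mat_apply, Pi.add_apply, xPart, if_true, Finset.prod_mul_distrib, dotProduct,
      zPart, bitSign_sum]
  · intro b _ hb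
    obtain ⟨j, hj⟩ := Function.ne_iff.1 hb
    rw [Finset.prod_eq_zero (Finset.mem_univ j), zero_mul]
    exact (Pauli1.mat_apply _ _ _).trans (if_neg hj)
  · simp

end Pauli

namespace QECC

section CosetState

variable {ι : Type} [Fintype ι] [DecidableEq ι] {C : BinCode ι}

open scoped Classical in
lemma cosetState_apply (C : BinCode ι) (v a : ι → ZMod 2) :
    cosetState C v a = if a - v ∈ C then ((Real.sqrt (Nat.card C) : ℝ) : ℂ)⁻¹ else 0 := by
  simp [cosetState, Set.indicator_apply]

lemma cosetState_apply_ne_zero_iff {v a : ι → ZMod 2} :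
    cosetState C v a ≠ 0 ↔ a - v ∈ C := by
  have h : (Nat.card C : ℝ) ≠ 0 := by exact_mod_cast Nat.card_pos.ne'
  have h' : ((Real.sqrt (Nat.card C) : ℝ) : ℂ)⁻¹ ≠ 0 := by
    rw [ne_eq, inv_eq_zero, ← ne_eq, Complex.ofReal_ne_zero, Real.sqrt_ne_zero']
    exact_mod_cast Nat.card_pos
  rw [cosetState_apply]
  split_ifs with hm <;> simp [hm, h']

lemma cosetState_congr {v w : ι → ZMod 2} (h : v - w ∈ C) :
    cosetState C v = cosetState C w := by
  ext a
  have : a - v ∈ C ↔ a - w ∈ C := by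
    rw [← sub_add_sub_cancel a v w]
    exact (C.add_mem_iff_left h).symm
  rw [cosetState_apply, cosetState_apply, this]

/-- A Pauli can map a coset state to another one only if its bit flips map the coset to the
other one. -/
lemma xPart_add_sub_mem_of_maps {P : Pauli ι} {v w : ι → ZMod 2} {c : ℂ}
    (h : c • P.op (cosetState C v) = cosetState C w) : w + P.xPart - v ∈ C := by
  rw [← cosetState_apply_ne_zero_iff]
  intro h0
  have h1 := congrArg (fun ψ : Qubits ι => ψ w) h
  simp only [PiLp.smul_apply, Pauli.op_apply, h0, mul_zero, smul_zero] at h1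
  exact cosetState_apply_ne_zero_iff.2 (by rw [sub_self]; exact zero_mem C) h1.symm

lemma norm_cosetState (C : BinCode ι) (v : ι → ZMod 2) : ‖cosetState C v‖ = 1 := by
  classical
  have hcard : (0 : ℝ) < Nat.card C := by exact_mod_cast Nat.card_pos
  have h : ∀ a, ‖cosetState C v a‖ ^ 2 = if a - v ∈ C then (Nat.card C : ℝ)⁻¹ else 0 := by
    intro a
    rw [cosetState_apply]
    split_ifs
    · rw [norm_inv, Complex.norm_real, Real.norm_of_nonneg (Real.sqrt_nonneg _), inv_pow,
        Real.sq_sqrt hcard.le]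
    · simp
  have hcoset : ∑ a, (if a - v ∈ C then (Nat.card C : ℝ)⁻¹ else 0) =
      ∑ a, if a ∈ C then (Nat.card C : ℝ)⁻¹ else 0 :=
    Equiv.sum_comp (Equiv.subRight v) fun a => if a ∈ C then (Nat.card C : ℝ)⁻¹ else 0
  have hC : (Finset.univ.filter fun a => a ∈ C).card = Nat.card C := by
    rw [Nat.card_eq_fintype_card, ← Fintype.card_subtype]
  rw [EuclideanSpace.norm_eq, Real.sqrt_eq_one]
  simp_rw [h]
  rw [hcoset, ← Finset.sum_filter, Finset.sum_const, hC, nsmul_eq_mul]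
  exact mul_inv_cancel₀ hcard.ne'

lemma inner_cosetState_eq_zero {v w : ι → ZMod 2} (h : v - w ∉ C) :
    inner ℂ (cosetState C v) (cosetState C w) = 0 := by
  rw [PiLp.inner_apply]
  refine Finset.sum_eq_zero fun a _ => ?_
  by_contra h0
  have hv : cosetState C v a ≠ 0 := fun hv => h0 (by rw [hv, inner_zero_left])
  have hw : cosetState C w a ≠ 0 := fun hw => h0 (by rw [hw, inner_zero_right])
  rw [cosetState_apply_ne_zero_iff] at hv hw
  exact h (by simpa using sub_mem hw hv)

end CosetState

/-! ### CSS codes -/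

section CSS

variable {ι : Type} [Fintype ι] [DecidableEq ι] {m : ℕ} {C₁ C₂ : BinCode ι}

/-- Existence of a CSS code: the coset states are orthonormal, hence extend to an orthonormal
basis, which is the image of the computational basis under an encoding unitary. -/
lemma exists_isCSS (hm : m ≤ Fintype.card ι) (hC : C₂ ≤ C₁)
    (r : (Fin m → ZMod 2) → ι → ZMod 2) (hr : ∀ x, r x ∈ C₁)
    (hr' : ∀ v ∈ C₁, ∃! x, v - r x ∈ C₂) : ∃ E : QECC ι m, E.IsCSS C₁ C₂ := by
  have hne : ∀ x y, x ≠ y → r x - r y ∉ C₂ := fun x y hxy h =>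
    hxy ((hr' _ (hr x)).unique (by rw [sub_self]; exact zero_mem _) h)
  have horth : Orthonormal ℂ fun x => cosetState C₂ (r x) :=
    ⟨fun x => norm_cosetState _ _, fun x y hxy => inner_cosetState_eq_zero (hne x y hxy)⟩
  let s : Set ((Fin m → ZMod 2) × (Fin (Fintype.card ι - m) → ZMod 2)) := {q | q.2 = 0}
  let ψ : (Fin m → ZMod 2) × (Fin (Fintype.card ι - m) → ZMod 2) → Qubits ι :=
    fun q => cosetState C₂ (r q.1)
  have horth' : Orthonormal ℂ (s.domRestrict ψ) := by
    refine horth.comp (fun q : s => q.1.1) ?_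
    rintro ⟨⟨x, z⟩, hz⟩ ⟨⟨y, w⟩, hw⟩ h
    change z = 0 at hz
    change w = 0 at hw
    subst hz hw
    change x = y at h
    rw [h]
  have hcard : Module.finrank ℂ (Qubits ι) =
      Fintype.card ((Fin m → ZMod 2) × (Fin (Fintype.card ι - m) → ZMod 2)) := by
    rw [finrank_euclideanSpace, Fintype.card_prod, Fintype.card_fun, Fintype.card_fun,
      Fintype.card_fun, ZMod.card, Fintype.card_fin, Fintype.card_fin, ← pow_add,
      Nat.add_sub_cancel' hm]
  obtain ⟨b, hb⟩ := horth'.exists_orthonormalBasis_extension_of_card_eq hcard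
  refine ⟨⟨b.repr.symm⟩, hC, r, hr, hr', fun x => ?_⟩
  rw [logical, OrthonormalBasis.repr_symm_single]
  exact hb (x, 0) rfl

/-- The distance of a CSS code is the least weight of a word of `C₁` outside `C₂`. -/
lemma IsCSS.distance_eq {E : QECC ι m} (hE : E.IsCSS C₁ C₂) {d : ℕ}
    (hd : ∀ v ∈ C₁, v ∉ C₂ → d ≤ hammingNorm v)
    (hd' : ∃ v ∈ C₁, v ∉ C₂ ∧ hammingNorm v = d) : E.distance = d := by
  obtain ⟨hC, r, hr, hr', hlog⟩ := hE
  apply le_antisymm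
  · obtain ⟨v, hv, hv', rfl⟩ := hd'
    let P : Pauli ι := fun j => if v j = 0 then .I else .X
    have hx : P.xPart = v := by
      funext j
      have two : ∀ a : ZMod 2, a ≠ 0 → a = 1 := by decide
      by_cases h : v j = 0
      · simp [Pauli.xPart, P, h, Pauli1.xBit]
      · simp [Pauli.xPart, P, Pauli1.xBit, two (v j) h]
    have hz : P.zPart = 0 := by
      funext j
      by_cases h : v j = 0 <;> simp [Pauli.zPart, P, h, Pauli1.zBit]
    have hph : ∏ j, (P j).phase = 1 := by
      refine Finset.prod_eq_one fun j _ => ?_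
      by_cases h : v j = 0 <;> simp [P, h, Pauli1.phase]
    have hw : P.weight = hammingNorm v := by
      refine congrArg Finset.card (Finset.filter_congr fun j _ => ?_)
      by_cases h : v j = 0 <;> simp [P, h]
    rw [← hw]
    obtain ⟨y, hy, -⟩ := hr' _ (add_mem hv (hr 0))
    refine iInf₂_le P ⟨0, y, ?_, 1, norm_one, fun _ => ?_⟩
    · rintro rfl
      exact hv' (by simpa using hy)
    · rw [hlog, hlog, ← cosetState_congr hy]
      ext a
      rw [one_smul, Pauli.op_apply, hx, hz, hph, zero_dotProduct, bitSign_zero, one_mul, one_mul,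
        cosetState_apply, cosetState_apply, ← sub_sub, sub_eq_add_neg a v, ZModModule.neg_eq_self]
  · refine le_iInf₂ fun P ⟨x, y, hxy, c, _, h⟩ => ?_
    have h := h ()
    rw [hlog, hlog] at h
    have hmem := xPart_add_sub_mem_of_maps h
    refine Nat.cast_le.2 (le_trans (hd _ ?_ ?_) P.hammingNorm_xPart_le_weight)
    · have := add_mem (sub_mem (hC hmem) (hr y)) (hr x)
      convert this using 1
      abel
    · intro hP
      refine hxy ((hr' _ (hr y)).unique ?_ (by rw [sub_self]; exact zero_mem _))
      convert sub_mem hmem hP using 1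
      abel

/-- For a CSS code of a code and its dual, the bit flips and the phase flips of a benign Pauli
are both words of the dual. -/
lemma IsCSS.mem_dual_of_benign {E : QECC ι m} (hE : E.IsCSS C₁ C₁.dual) {P : Pauli ι}
    (hP : E.Benign P) : P.xPart ∈ C₁.dual ∧ P.zPart ∈ C₁.dual := by
  obtain ⟨hC, r, hr, hr', hlog⟩ := hE
  obtain ⟨c, -, h⟩ := hP
  have hx : P.xPart ∈ C₁.dual := by
    have h := h 0
    rw [hlog] at h
    simpa using xPart_add_sub_mem_of_maps h
  refine ⟨hx, ?_⟩
  -- The eigenvalue is the same on all of `C₁`, and at `0` there is no sign.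
  have key : ∀ u ∈ C₁, c * (∏ j, (P j).phase) * bitSign (P.zPart ⬝ᵥ u) = 1 := by
    intro u hu
    obtain ⟨y, hy, -⟩ := hr' u hu
    have h1 := congrArg (fun ψ : Qubits ι => ψ (u + P.xPart)) (h y)
    simp only [hlog, PiLp.smul_apply, Pauli.op_apply, smul_eq_mul] at h1
    rw [add_assoc, ZModModule.add_self, add_zero, cosetState_apply, cosetState_apply,
      if_pos hy, if_pos (by simpa [add_sub_right_comm] using add_mem hy hx)] at h1
    have hne : ((Real.sqrt (Nat.card C₁.dual) : ℝ) : ℂ)⁻¹ ≠ 0 := by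
      rw [ne_eq, inv_eq_zero, ← ne_eq, Complex.ofReal_ne_zero, Real.sqrt_ne_zero']
      exact_mod_cast Nat.card_pos
    rw [← mul_assoc, ← mul_assoc] at h1
    exact mul_right_cancel₀ hne (h1.trans (one_mul _).symm)
  intro u hu
  have h0 := key 0 (zero_mem _)
  rw [dotProduct_zero, bitSign_zero, mul_one] at h0
  have hu := key u hu
  rwa [h0, one_mul, bitSign_eq_one_iff, dotProduct_comm] at hu

end CSS

end QECC

/-! ### Packing bounds -/

section Packing

variable {ι : Type} [Fintype ι]

lemma hammingNorm_sub_one_add (v : ι → ZMod 2) :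
    hammingNorm (v - 1) + hammingNorm v = Fintype.card ι := by
  rw [← Finset.card_univ, Finset.card_eq_sum_ones]
  simp only [hammingNorm, Finset.card_filter, ← Finset.sum_add_distrib]
  refine Finset.sum_congr rfl fun j _ => ?_
  have key : ∀ a : ZMod 2, ((if a - 1 ≠ 0 then 1 else 0) + if a ≠ 0 then 1 else 0) = 1 := by decide
  exact key (v j)

variable [DecidableEq ι]

/-- A packing bound: the `(w - t)`-subsets of sets of size `w` are all different if the pairwise
intersections of these sets are smaller than `w - t`. -/
lemma card_mul_choose_le_choose {𝒜 : Finset (Finset ι)} {w t : ℕ} (ht : t ≤ w)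
    (hw : ∀ A ∈ 𝒜, A.card = w)
    (hinter : ∀ A ∈ 𝒜, ∀ B ∈ 𝒜, A ≠ B → (A ∩ B).card < w - t) :
    𝒜.card * (Fintype.card ι - (w - t)).choose t ≤ (Fintype.card ι).choose w := by
  have hdisj : (𝒜 : Set (Finset ι)).PairwiseDisjoint fun A => A.powersetCard (w - t) := by
    intro A hA B hB hAB
    rw [Function.onFun, Finset.disjoint_left]
    intro S hSA hSB
    rw [Finset.mem_powersetCard] at hSA hSB
    have h1 := Finset.card_le_card (Finset.subset_inter hSA.1 hSB.1)
    have h2 := hinter A hA B hB hAB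
    omega
  have hunion : 𝒜.card * w.choose (w - t) ≤ (Fintype.card ι).choose (w - t) := by
    have h1 : (𝒜.biUnion fun A => A.powersetCard (w - t)).card = 𝒜.card * w.choose (w - t) := by
      rw [Finset.card_biUnion hdisj, Finset.sum_const_nat]
      intro A hA
      rw [Finset.card_powersetCard, hw A hA]
    rw [← h1, ← Finset.card_univ, ← Finset.card_powersetCard]
    refine Finset.card_le_card fun S hS => ?_
    obtain ⟨A, -, hSA⟩ := Finset.mem_biUnion.1 hS
    exact Finset.mem_powersetCard.2 ⟨Finset.subset_univ _, (Finset.mem_powersetCard.1 hSA).2⟩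
  have hpos : 0 < w.choose (w - t) := Nat.choose_pos (Nat.sub_le _ _)
  refine Nat.le_of_mul_le_mul_right ?_ hpos
  have hmul := Nat.choose_mul (n := Fintype.card ι) (k := w) (s := w - t) (Nat.sub_le _ _)
  rw [Nat.sub_sub_self ht] at hmul
  rw [hmul, mul_right_comm]
  exact Nat.mul_le_mul_right _ hunion

lemma two_pow_le_choose_two_mul (t : ℕ) : 2 ^ t ≤ (2 * t).choose t := by
  change 2 ^ t ≤ Nat.centralBinom t
  induction t with
  | zero => simp
  | succ t ih =>
    have h := Nat.succ_mul_centralBinom_succ t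
    rw [pow_succ]
    nlinarith

/-- In a symmetric set `A` of words, the positions of the letters with property `q` are equally
distributed over the sets of a given size. Hence a bound on the proportion of a family of such
sets is a bound on the proportion of a subset `B` of `A`. -/
lemma card_mul_le_card_of_perm_invariant {β : Type} [DecidableEq β] {A B : Finset (ι → β)}
    (q : β → Prop) [DecidablePred q] {k N : ℕ} {𝒜 : Finset (Finset ι)}
    (hA : ∀ P ∈ A, ∀ σ : Equiv.Perm ι, P ∘ σ ∈ A)
    (hk : ∀ P ∈ A, (Finset.univ.filter fun j => q (P j)).card = k)
    (hBA : B ⊆ A) (hB : ∀ P ∈ B, (Finset.univ.filter fun j => q (P j)) ∈ 𝒜)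
    (h𝒜 : ∀ S ∈ 𝒜, S.card = k) (hN : 𝒜.card * N ≤ (Fintype.card ι).choose k) :
    B.card * N ≤ A.card := by
  let pos : (ι → β) → Finset ι := fun P => Finset.univ.filter fun j => q (P j)
  have hle : ∀ S S' : Finset ι, S.card = k → S'.card = k →
      (A.filter fun P => pos P = S).card ≤ (A.filter fun P => pos P = S').card := by
    intro S S' hS hS'
    let σ : Equiv.Perm ι := (Finset.equivOfCardEq (hS'.trans hS.symm)).extendSubtype
    refine Finset.card_le_card_of_injOn (fun P => P ∘ σ) ?_
      (fun P _ Q _ h => σ.surjective.injective_comp_right h)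
    intro P hP
    obtain ⟨hPA, hPS⟩ := Finset.mem_filter.1 (Finset.mem_coe.1 hP)
    refine Finset.mem_coe.2 (Finset.mem_filter.2 ⟨hA P hPA σ, ?_⟩)
    ext j
    have hj : q (P (σ j)) ↔ σ j ∈ S := by simp [← hPS, pos]
    simp only [pos, Finset.mem_filter, Finset.mem_univ, true_and, Function.comp_apply, hj]
    constructor
    · intro h
      by_contra hjS
      exact Equiv.extendSubtype_not_mem _ j hjS h
    · exact Equiv.extendSubtype_mem (Finset.equivOfCardEq (hS'.trans hS.symm)) j
  obtain ⟨M, hM⟩ : ∃ M, ∀ S : Finset ι, S.card = k → (A.filter fun P => pos P = S).card = M := by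
    by_cases h : ∃ S : Finset ι, S.card = k
    · obtain ⟨S, hS⟩ := h
      exact ⟨_, fun S' hS' => le_antisymm (hle S' S hS' hS) (hle S S' hS hS')⟩
    · exact ⟨0, fun S hS => (h ⟨S, hS⟩).elim⟩
  have hAcard : A.card = (Fintype.card ι).choose k * M := by
    rw [Finset.card_eq_sum_card_fiberwise (f := pos) (t := Finset.univ.powersetCard k)
      fun P hP => Finset.mem_coe.2 (Finset.mem_powersetCard.2 ⟨Finset.subset_univ _, hk P hP⟩),
      Finset.sum_const_nat fun S hS => hM S (Finset.mem_powersetCard.1 hS).2,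
      Finset.card_powersetCard, Finset.card_univ]
  have hBcard : B.card ≤ 𝒜.card * M := by
    rw [Finset.card_eq_sum_card_fiberwise (f := pos) (t := 𝒜) hB, ← smul_eq_mul]
    refine Finset.sum_le_card_nsmul _ _ _ fun S hS => ?_
    rw [← hM S (h𝒜 S hS)]
    exact Finset.card_le_card (Finset.filter_subset_filter _ hBA)
  calc B.card * N ≤ 𝒜.card * M * N := Nat.mul_le_mul_right _ hBcard
    _ = 𝒜.card * N * M := mul_right_comm _ _ _
    _ ≤ _ := by rw [hAcard]; exact Nat.mul_le_mul_right _ hN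

lemma hammingNorm_sub_add_two_mul_card_inter (u v : ι → ZMod 2) :
    hammingNorm (u - v) + 2 * ((Finset.univ.filter fun j => u j ≠ 0) ∩
      (Finset.univ.filter fun j => v j ≠ 0)).card = hammingNorm u + hammingNorm v := by
  rw [← Finset.filter_and]
  simp only [hammingNorm, Finset.card_filter, Finset.mul_sum, ← Finset.sum_add_distrib]
  refine Finset.sum_congr rfl fun j _ => ?_
  have key : ∀ a b : ZMod 2, ((if a - b ≠ 0 then 1 else 0) + 2 * if a ≠ 0 ∧ b ≠ 0 then 1 else 0) =
      (if a ≠ 0 then 1 else 0) + if b ≠ 0 then 1 else 0 := by decide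
  exact key (u j) (v j)

/-- In a symmetric set `A` of words over `β` whose images under `g` have a fixed positive weight,
the proportion of those whose image lies in a code is exponentially small in the minimum weight
of the code, if the code also has no words of nearly full weight. -/
lemma card_mul_two_pow_le_card {β : Type} [DecidableEq β] {C : BinCode ι} {t : ℕ}
    (hC : ∀ v ∈ C, v ≠ 0 → 2 * t < hammingNorm v ∧ hammingNorm v + t ≤ Fintype.card ι)
    (g : β → ZMod 2) {k : ℕ} (hk0 : k ≠ 0) {A B : Finset (ι → β)}
    (hA : ∀ P ∈ A, ∀ σ : Equiv.Perm ι, P ∘ σ ∈ A)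
    (hk : ∀ P ∈ A, hammingNorm (g ∘ P) = k) (hBA : B ⊆ A) (hB : ∀ P ∈ B, g ∘ P ∈ C) :
    B.card * 2 ^ t ≤ A.card := by
  classical
  rcases B.eq_empty_or_nonempty with rfl | ⟨P₀, hP₀⟩
  · simp
  have hne : ∀ v : ι → ZMod 2, hammingNorm v = k → v ≠ 0 := by
    rintro _ h rfl
    exact hk0 (h ▸ hammingNorm_zero)
  obtain ⟨hk1, hk2⟩ := hC _ (hB P₀ hP₀) (hne _ (hk P₀ (hBA hP₀)))
  rw [hk P₀ (hBA hP₀)] at hk1 hk2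
  let 𝒜 : Finset (Finset ι) := (Finset.univ.filter fun v => v ∈ C ∧ hammingNorm v = k).image
    fun v => Finset.univ.filter fun j => v j ≠ 0
  have h𝒜 : ∀ S ∈ 𝒜, ∃ v ∈ C, hammingNorm v = k ∧ (Finset.univ.filter fun j => v j ≠ 0) = S := by
    intro S hS
    obtain ⟨v, hv, hvS⟩ := Finset.mem_image.1 hS
    obtain ⟨-, hvC, hvk⟩ := Finset.mem_filter.1 hv
    exact ⟨v, hvC, hvk, hvS⟩
  have h𝒜k : ∀ S ∈ 𝒜, S.card = k := by
    intro S hS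
    obtain ⟨v, -, hvk, rfl⟩ := h𝒜 S hS
    exact hvk
  refine card_mul_le_card_of_perm_invariant (fun s => g s ≠ 0) (k := k) (𝒜 := 𝒜) hA hk hBA
    ?_ h𝒜k ?_
  · intro P hP
    exact Finset.mem_image.2 ⟨g ∘ P, Finset.mem_filter.2
      ⟨Finset.mem_univ _, hB P hP, hk P (hBA hP)⟩, rfl⟩
  · refine le_trans (Nat.mul_le_mul_left _ ?_)
      (card_mul_choose_le_choose (t := t) (by omega) h𝒜k ?_)
    · exact (two_pow_le_choose_two_mul t).trans (Nat.choose_le_choose _ (by omega))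
    · intro S hS S' hS' hSS'
      obtain ⟨u, hu, huk, rfl⟩ := h𝒜 S hS
      obtain ⟨v, hv, hvk, rfl⟩ := h𝒜 S' hS'
      have h1 := hammingNorm_sub_add_two_mul_card_inter u v
      have h2 := (hC _ (sub_mem hu hv) (sub_ne_zero.2 (by rintro rfl; exact hSS' rfl))).1
      omega

end Packing

/-! ### Weight-sparsity -/

section Sparse

variable {ι : Type} [Fintype ι]

lemma Pauli.count_comp_perm (s : Pauli1) (P : Pauli ι) (σ : Equiv.Perm ι) :
    Pauli.count s (P ∘ σ) = Pauli.count s P := by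
  simp only [Pauli.count, Finset.card_filter]
  exact Equiv.sum_comp σ fun j => if P j = s then 1 else 0

lemma Pauli.hammingNorm_xPart (P : Pauli ι) :
    hammingNorm P.xPart = P.count .X + P.count .Y := by
  simp only [hammingNorm, Pauli.count, Finset.card_filter, ← Finset.sum_add_distrib]
  refine Finset.sum_congr rfl fun j _ => ?_
  rw [Pauli.xPart]
  cases P j <;> simp [Pauli1.xBit]

lemma Pauli.hammingNorm_zPart (P : Pauli ι) :
    hammingNorm P.zPart = P.count .Y + P.count .Z := by
  simp only [hammingNorm, Pauli.count, Finset.card_filter, ← Finset.sum_add_distrib]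
  refine Finset.sum_congr rfl fun j _ => ?_
  rw [Pauli.zPart]
  cases P j <;> simp [Pauli1.zBit]

variable [DecidableEq ι]

/-- The fraction of benign Paulis is bounded in terms of the bit flips, or of the phase flips if
the profile has no bit flips. -/
lemma QECC.IsCSS.maxBenignFraction_le {m : ℕ} {E : QECC ι m} {C : BinCode ι}
    (hE : E.IsCSS C C.dual) {t : ℕ}
    (hC : ∀ v ∈ C.dual, v ≠ 0 → 2 * t < hammingNorm v ∧ hammingNorm v + t ≤ Fintype.card ι) :
    E.maxBenignFraction ≤ (2 ^ t)⁻¹ := by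
  classical
  refine Finset.sup_le fun w hw => ?_
  obtain ⟨-, -, hw0⟩ := Finset.mem_filter.1 hw
  let A : Finset (Pauli ι) := (paulisOfProfile ι w).toFinset
  let B : Finset (Pauli ι) := (E.benignOfProfile w).toFinset
  have hA : ∀ P ∈ A, ∀ σ : Equiv.Perm ι, P ∘ σ ∈ A := by
    intro P hP σ
    have hP : P ∈ paulisOfProfile ι w := Set.mem_toFinset.1 hP
    refine Set.mem_toFinset.2 ?_
    simpa only [paulisOfProfile, Set.mem_ofPred_eq, Pauli.count_comp_perm] using hP
  have hBA : B ⊆ A := fun P hP => Set.mem_toFinset.2 (Set.mem_toFinset.1 hP).1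
  have hAw : ∀ P ∈ A, P.count .X = w.1 ∧ P.count .Y = w.2.1 ∧ P.count .Z = w.2.2 :=
    fun P hP => (Set.mem_toFinset.1 hP : P ∈ paulisOfProfile ι w)
  have hB : ∀ P ∈ B, P.xPart ∈ C.dual ∧ P.zPart ∈ C.dual :=
    fun P hP => hE.mem_dual_of_benign (Set.mem_toFinset.1 hP).2
  have key : B.card * 2 ^ t ≤ A.card := by
    by_cases hx : w.1 + w.2.1 = 0
    · refine card_mul_two_pow_le_card hC Pauli1.zBit (k := w.2.1 + w.2.2) ?_ hA
        (fun P hP => ?_) hBA fun P hP => (hB P hP).2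
      · rintro hz
        exact hw0 (Prod.ext (by simp; omega) (Prod.ext (by simp; omega) (by simp; omega)))
      · rw [← (hAw P hP).2.1, ← (hAw P hP).2.2]
        exact Pauli.hammingNorm_zPart P
    · refine card_mul_two_pow_le_card hC Pauli1.xBit (k := w.1 + w.2.1) hx hA
        (fun P hP => ?_) hBA fun P hP => (hB P hP).1
      rw [← (hAw P hP).2.1, ← (hAw P hP).1]
      exact Pauli.hammingNorm_xPart P
  rw [Set.ncard_eq_toFinset_card', Set.ncard_eq_toFinset_card']
  refine div_le_of_le_mul₀ zero_le zero_le ?_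
  rw [inv_mul_eq_div, le_div_iff₀ (by positivity)]
  exact_mod_cast key

lemma QECC.IsCSS.le_benignDistance {m : ℕ} {E : QECC ι m} {C : BinCode ι}
    (hE : E.IsCSS C C.dual) {d : ℕ} (hd : ∀ v ∈ C.dual, v ≠ 0 → d ≤ hammingNorm v) :
    (d : ℕ∞) ≤ E.benignDistance := by
  refine le_iInf₂ fun P ⟨hP, hben⟩ => Nat.cast_le.2 ?_
  obtain ⟨hx, hz⟩ := hE.mem_dual_of_benign hben
  by_cases hx0 : P.xPart = 0
  · by_cases hz0 : P.zPart = 0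
    · exact (hP (Pauli.eq_identity_of_xPart_zPart_eq_zero hx0 hz0)).elim
    · exact (hd _ hz hz0).trans P.hammingNorm_zPart_le_weight
  · exact (hd _ hx hx0).trans P.hammingNorm_xPart_le_weight

end Sparse

/-! ### The punctured Reed-Muller quantum codes -/

section RM

lemma exists_isRM (i : ℕ) (p : Fin (2 * i + 1) → ZMod 2) :
    ∃ R : QECC (RMQubit i p) 1, R.IsRM := by
  have hcard : 1 ≤ Fintype.card (RMQubit i p) := by
    rw [card_RMQubit, pow_succ]
    have := Nat.one_le_two_pow (n := 2 * i)
    omega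
  refine QECC.exists_isCSS hcard dual_puncturedRM_le (fun x => x 0 • 1)
    (fun x => Submodule.smul_mem _ _ one_mem_puncturedRM) fun v hv => ?_
  have hdiff : ∀ x y : Fin 1 → ZMod 2, v - x 0 • 1 ∈ (puncturedRM i p).dual →
      v - y 0 • 1 ∈ (puncturedRM i p).dual → x = y := by
    intro x y hx hy
    have h := sub_mem hy hx
    rw [sub_sub_sub_cancel_left, ← sub_smul] at h
    funext j
    rw [Subsingleton.elim j 0]
    by_contra hne
    have two : ∀ a b : ZMod 2, a ≠ b → a - b = 1 := by decide
    rw [two _ _ hne, one_smul] at h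
    exact one_notMem_dual_puncturedRM h
  rcases mem_dual_or_sub_one_mem_dual hv with h | h
  · have h' : v - (0 : Fin 1 → ZMod 2) 0 • 1 ∈ (puncturedRM i p).dual := by simpa using h
    exact ⟨0, h', fun y hy => hdiff _ _ hy h'⟩
  · have h' : v - (1 : Fin 1 → ZMod 2) 0 • 1 ∈ (puncturedRM i p).dual := by simpa using h
    exact ⟨1, h', fun y hy => hdiff _ _ hy h'⟩

lemma hammingNorm_add_le_of_mem_dual_puncturedRM {i : ℕ} {p : Fin (2 * i + 1) → ZMod 2}
    {v : RMQubit i p → ZMod 2} (hv : v ∈ (puncturedRM i p).dual) :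
    hammingNorm v + (2 ^ (i + 1) - 1) ≤ Fintype.card (RMQubit i p) := by
  rw [← hammingNorm_sub_one_add v, add_comm]
  refine Nat.add_le_add_right (le_hammingNorm_of_mem_puncturedRM
    (sub_mem (dual_puncturedRM_le hv) one_mem_puncturedRM) fun h => ?_) _
  rw [sub_eq_zero] at h
  exact one_notMem_dual_puncturedRM (h ▸ hv)

lemma maxBenignFraction_le_of_isRM {i : ℕ} {p : Fin (2 * i + 1) → ZMod 2}
    {R : QECC (RMQubit i p) 1} (hR : R.IsRM) : R.maxBenignFraction ≤ (2 ^ (2 ^ i - 1))⁻¹ := by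
  refine hR.maxBenignFraction_le fun v hv hv0 => ?_
  have h1 := le_hammingNorm_of_mem_dual_puncturedRM hv hv0
  have h2 := hammingNorm_add_le_of_mem_dual_puncturedRM hv
  have h3 := Nat.one_le_two_pow (n := i)
  rw [pow_succ] at h1 h2
  omega

lemma exists_forall_ge_mul_lt_two_pow (c : ℕ) :
    ∃ i₀ : ℕ, ∀ i ≥ i₀, (2 * i + 1) * c < 2 ^ i - 1 := by
  have h := tendsto_pow_const_div_const_pow_of_one_lt 1 (one_lt_two : (1 : ℝ) < 2)
  have h' := h.eventually (gt_mem_nhds (show (0 : ℝ) < 1 / (3 * c + 2) by positivity))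
  obtain ⟨i₀, hi₀⟩ := Filter.eventually_atTop.1 h'
  refine ⟨i₀ + 1, fun i hi => ?_⟩
  have h1 := hi₀ i (by omega)
  rw [div_lt_div_iff₀ (by positivity) (by positivity), pow_one, one_mul] at h1
  have h2 : i * (3 * c + 2) < 2 ^ i := by exact_mod_cast h1
  have h3 : (2 * i + 1) * c ≤ i * (3 * c) := by nlinarith
  have h4 : i * (3 * c + 2) = i * (3 * c) + 2 * i := by ring
  omega

lemma weightSparse_of_isRM {p : ∀ i : ℕ, Fin (2 * i + 1) → ZMod 2}
    {R : ∀ i, QECC (RMQubit i (p i)) 1} (hR : ∀ i, (R i).IsRM) : WeightSparse R := by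
  intro c
  obtain ⟨i₀, hi₀⟩ := exists_forall_ge_mul_lt_two_pow c
  refine ⟨i₀, fun i hi => ?_⟩
  have h1 : ((R i).maxBenignFraction : ℝ) ≤ (2 ^ (2 ^ i - 1))⁻¹ := by
    exact_mod_cast maxBenignFraction_le_of_isRM (hR i)
  refine h1.trans_lt ?_
  have hpos : 0 < Fintype.card (RMQubit i (p i)) := by
    rw [card_RMQubit, pow_succ]
    have := Nat.one_le_two_pow (n := 2 * i)
    omega
  have hpos' : (0 : ℝ) < Fintype.card (RMQubit i (p i)) := by exact_mod_cast hpos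
  refine inv_strictAnti₀ (pow_pos hpos' c) ?_
  change (Fintype.card (RMQubit i (p i)) : ℝ) ^ c < _
  have h2 : Fintype.card (RMQubit i (p i)) ^ c < 2 ^ (2 ^ i - 1) :=
    calc Fintype.card (RMQubit i (p i)) ^ c ≤ (2 ^ (2 * i + 1)) ^ c := by
          rw [card_RMQubit]
          exact Nat.pow_le_pow_left (Nat.sub_le _ _) c
      _ = 2 ^ ((2 * i + 1) * c) := (pow_mul _ _ _).symm
      _ < _ := Nat.pow_lt_pow_right one_lt_two (hi₀ i hi)
  exact_mod_cast h2

lemma distance_eq_of_isRM {i : ℕ} {p : Fin (2 * i + 1) → ZMod 2}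
    {R : QECC (RMQubit i p) 1} (hR : R.IsRM) :
    R.distance = ((2 ^ (i + 1) - 1 : ℕ) : ℕ∞) :=
  hR.distance_eq
    (fun _ hv hv' => le_hammingNorm_of_mem_puncturedRM hv fun h => hv' (h ▸ zero_mem _))
    (exists_mem_puncturedRM_hammingNorm_eq i p)

lemma distance_le_benignDistance_of_isRM {i : ℕ} {p : Fin (2 * i + 1) → ZMod 2}
    {R : QECC (RMQubit i p) 1} (hR : R.IsRM) : R.distance ≤ R.benignDistance := by
  rw [distance_eq_of_isRM hR]
  exact hR.le_benignDistance fun v hv hv0 =>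
    le_hammingNorm_of_mem_puncturedRM (dual_puncturedRM_le hv) hv0

end RM

end

theorem mainTheorem5 (p : ∀ i : ℕ, Fin (2 * i + 1) → ZMod 2) :
    (∀ i, (reedMuller i (2 * i + 1)).dual = reedMuller i (2 * i + 1)) ∧
    (∀ i, Fintype.card (RMQubit i (p i)) = 2 ^ (2 * i + 1) - 1) ∧
    (∀ i, ∃ R : QECC (RMQubit i (p i)) 1, R.IsRM) ∧
    ∀ R : ∀ i, QECC (RMQubit i (p i)) 1, (∀ i, (R i).IsRM) →
      WeightSparse R ∧
      ∀ i, (R i).distance = ((2 ^ (i + 1) - 1 : ℕ) : ℕ∞) ∧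
        (R i).distance ≤ (R i).benignDistance :=
  ⟨dual_reedMuller, fun i => card_RMQubit i (p i), fun i => exists_isRM i (p i), fun _ hR =>
    ⟨weightSparse_of_isRM hR, fun i =>
      ⟨distance_eq_of_isRM (hR i), distance_le_benignDistance_of_isRM (hR i)⟩⟩⟩
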